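/- Let $(M,h)$ be a Brinkmann wave, i.e. a smooth Lorentzian manifold (signature $(-,+,\dots,+)$) together with a smooth vector field $X$ which is light-like ($X_p\neq 0$ and $h(X_p,X_p)=0$ for all $p\in M$) and parallel for the Levi-Civita connection, $\nabla X=0$. Let $\Xi=\mathbb{R}X\subset TM$ and $\Xi^\perp=\{U\in TM\mid h(U,X)=0\}$, let $\mathcal{R}(U,V)=[\nabla_U,\nabla_V]-\nabla_{[U,V]}$ be the curvature of $\nabla$, and write $\mathcal{R}(U,V,W,Z)=h(\mathcal{R}(U,V)W,Z)$. Then $(M,h)$ has light-like hypersurface curvature, i.e. $$\mathcal{R}(U,V)W\in\Xi_p\quad\text{for all } p\in M \text{ and all } U,V,W\in\Xi^\perp_p,$$ if and only if $\|\mathcal{R}\|^2=0$ at every point of $M$, where $$\|\mathcal{R}\|^2=\mathrm{tr}_{(1,5)(2,6)(3,7)(4,8)}(\mathcal{R}\otimes\mathcal{R})=\sum h^{ii'}h^{jj'}h^{kk'}h^{ll'}\,\mathcal{R}_{ijkl}\,\mathcal{R}_{i'j'k'l'}$$ is the full metric contraction of $\mathcal{R}\otimes\mathcal{R}$ (with respect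 to any basis of the tangent space, $(h^{ij})$ being the inverse of the matrix $(h_{ij})$). -/

import Mathlib

open scoped Manifold ContDiff Bundle

noncomputable section

variable {E : Type*} [NormedAddCommGroup E] [NormedSpace ℝ E]
  {M : Type*} [TopologicalSpace M] [ChartedSpace E M]

variable (E M) in
/-- A smooth Lorentzian metric, of signature (-,+,...,+), on a smooth manifold `M` modelled on `E`.
The signature condition: there is a time-like vector on whose orthogonal complement the metric is
positive definite. -/
structure LorentzianMetric [IsManifold 𝓘(ℝ, E) ∞ M] where
  /-- The scalar product on each tangent space. -/
  inner (x : M) : TangentSpace 𝓘(ℝ, E) x →L[ℝ] TangentSpace 𝓘(ℝ, E) x →L[ℝ] ℝ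
  symm (x : M) (u v : TangentSpace 𝓘(ℝ, E) x) : inner x u v = inner x v u
  lorentzian (x : M) : ∃ t : TangentSpace 𝓘(ℝ, E) x, inner x t t < 0 ∧
    ∀ v : TangentSpace 𝓘(ℝ, E) x, inner x t v = 0 → v ≠ 0 → 0 < inner x v v
  contMDiff : ContMDiff 𝓘(ℝ, E) (𝓘(ℝ, E).prod 𝓘(ℝ, E →L[ℝ] E →L[ℝ] ℝ)) ∞
    (fun x ↦ Bundle.TotalSpace.mk' (E →L[ℝ] E →L[ℝ] ℝ)
      (E := fun x : M ↦ TangentSpace 𝓘(ℝ, E) x →L[ℝ] TangentSpace 𝓘(ℝ, E) x →L[ℝ] ℝ) x (inner x))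

/-! ### Coordinate expressions in the chart around a point `p` -/

/-- The coordinate frame at `q` of the chart around `p`: it sends `∑ aⁱ eᵢ ∈ E` to the tangent
vector `∑ aⁱ ∂ᵢ` at `q`. -/
def coordFrame [IsManifold 𝓘(ℝ, E) ∞ M] (p q : M) : E →L[ℝ] TangentSpace 𝓘(ℝ, E) q :=
  (trivializationAt E (TangentSpace 𝓘(ℝ, E) : M → Type _) p).symmL ℝ q

/-- The components of a tangent vector at `q` with respect to the coordinate frame of the chart
around `p`. -/
def coordComponents [IsManifold 𝓘(ℝ, E) ∞ M] (p q : M) : TangentSpace 𝓘(ℝ, E) q →L[ℝ] E :=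
  (trivializationAt E (TangentSpace 𝓘(ℝ, E) : M → Type _) p).continuousLinearMapAt ℝ q

/-- The components of the vector field `X` in the chart around `p`, as a function of the
coordinates `y`. -/
def coordField [IsManifold 𝓘(ℝ, E) ∞ M] (X : ∀ x : M, TangentSpace 𝓘(ℝ, E) x) (p : M) (y : E) : E :=
  coordComponents p ((extChartAt 𝓘(ℝ, E) p).symm y) (X ((extChartAt 𝓘(ℝ, E) p).symm y))

namespace LorentzianMetric

variable [IsManifold 𝓘(ℝ, E) ∞ M] (h : LorentzianMetric E M)

/-- The components `h_{ij}` of the metric in the chart around `p`, as a function of the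
coordinates `y`: the bilinear form `(a, b) ↦ h(∑ aⁱ ∂ᵢ, ∑ bʲ ∂ⱼ)`. -/
def coord (p : M) (y : E) : E →L[ℝ] E →L[ℝ] ℝ :=
  ContinuousLinearMap.precomp ℝ (coordFrame p ((extChartAt 𝓘(ℝ, E) p).symm y)) ∘L
    h.inner ((extChartAt 𝓘(ℝ, E) p).symm y) ∘L coordFrame p ((extChartAt 𝓘(ℝ, E) p).symm y)

/-- Christoffel symbols of the first kind: the covector
`z ↦ ½ (∂ᵤ h(v, z) + ∂ᵥ h(u, z) - ∂_z h(u, v))` at `y`. -/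
def christoffelLower (p : M) (y u v : E) : E →L[ℝ] ℝ :=
  (1 / 2 : ℝ) • (fderiv ℝ (h.coord p) y u v + fderiv ℝ (h.coord p) y v u
    - ((fderiv ℝ (h.coord p) y).flip u).flip v)

/-- Christoffel symbols `Γ(u, v) = uⁱ vʲ Γᵏᵢⱼ ∂ₖ` of the Levi-Civita connection in the chart
around `p`, at the coordinates `y`: the index of `christoffelLower` is raised with the inverse of
the (nondegenerate) metric. -/
def christoffel (p : M) (y u v : E) : E :=
  (h.coord p y).inverse (h.christoffelLower p y u v)

/-- The covariant derivative `∇_v X = ∂_v X + Γ(v, X)` of the vector field `X` with respect to the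
Levi-Civita connection, in the chart around `p`, at the coordinates `y`. -/
def coordCovDeriv (X : ∀ x : M, TangentSpace 𝓘(ℝ, E) x) (p : M) (y v : E) : E :=
  fderiv ℝ (coordField X p) y v + h.christoffel p y v (coordField X p y)

/-- The vector field `X` is parallel: `∇ X = 0`, in the chart around each point, on the whole domain of
that chart. -/
def IsParallel (X : ∀ x : M, TangentSpace 𝓘(ℝ, E) x) : Prop :=
  ∀ p : M, ∀ y ∈ (extChartAt 𝓘(ℝ, E) p).target, ∀ v : E, h.coordCovDeriv X p y v = 0

/-- The curvature `R(u, v) w = ∇ᵤ ∇ᵥ w - ∇ᵥ ∇ᵤ w - ∇_{[u, v]} w` of the Levi-Civita connection for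
coordinate vector fields `u, v, w`, in the chart around `p`, at the coordinates `y`. -/
def coordCurvature (p : M) (y u v w : E) : E :=
  fderiv ℝ (fun y' ↦ h.christoffel p y' v w) y u - fderiv ℝ (fun y' ↦ h.christoffel p y' u w) y v
    + h.christoffel p y u (h.christoffel p y v w) - h.christoffel p y v (h.christoffel p y u w)

/-- The curvature tensor `R(u, v) w` of `(M, h)` at the point `p`. -/
def curvature (p : M) (u v w : TangentSpace 𝓘(ℝ, E) p) : TangentSpace 𝓘(ℝ, E) p :=
  coordFrame p p (h.coordCurvature p (extChartAt 𝓘(ℝ, E) p p)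
    (coordComponents p p u) (coordComponents p p v) (coordComponents p p w))

/-- The `(4,0)`-curvature tensor `R(u, v, w, z) = h(R(u, v) w, z)` at the point `p`. -/
def curvature₄ (p : M) (u v w z : TangentSpace 𝓘(ℝ, E) p) : ℝ :=
  h.inner p (h.curvature p u v w) z

/-- A light-like vector field: nowhere zero and null. -/
def IsLightlike (X : ∀ x : M, TangentSpace 𝓘(ℝ, E) x) : Prop :=
  ∀ p : M, X p ≠ 0 ∧ h.inner p (X p) (X p) = 0

/-- `X` is a smooth light-like parallel vector field of `(M, h)`, i.e. `(M, h)` is a Brinkmann wave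
with distinguished vector field `X`. -/
structure IsBrinkmannWave (X : ∀ x : M, TangentSpace 𝓘(ℝ, E) x) : Prop where
  contMDiff : ContMDiff 𝓘(ℝ, E) 𝓘(ℝ, E).tangent ∞
    (fun x ↦ (⟨x, X x⟩ : TangentBundle 𝓘(ℝ, E) M))
  lightlike : h.IsLightlike X
  parallel : h.IsParallel X

/-- The fibre at `p` of the line distribution `Ξ` spanned by `X`. -/
def lineDistribution (X : ∀ x : M, TangentSpace 𝓘(ℝ, E) x) (p : M) :
    Submodule ℝ (TangentSpace 𝓘(ℝ, E) p) :=
  Submodule.span ℝ {X p}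

/-- The fibre at `p` of the distribution `Ξ^⊥ = {U | h(U, X) = 0}`. -/
def orthDistribution (X : ∀ x : M, TangentSpace 𝓘(ℝ, E) x) (p : M) :
    Set (TangentSpace 𝓘(ℝ, E) p) :=
  {u | h.inner p u (X p) = 0}

/-- Light-like hypersurface curvature, for the distributions `Ξ` and `Ξ^⊥` defined by `X`:
`R(U, V)` maps `Ξ^⊥` to `Ξ` for all `U, V ∈ Ξ^⊥`. -/
def HasLightlikeHypersurfaceCurvature (X : ∀ x : M, TangentSpace 𝓘(ℝ, E) x) : Prop :=
  ∀ p : M, ∀ u ∈ h.orthDistribution X p, ∀ v ∈ h.orthDistribution X p,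
    ∀ w ∈ h.orthDistribution X p, h.curvature p u v w ∈ lineDistribution X p

/-- The inverse metric `h^{ij}` at `p` with respect to a basis `b` of the tangent space: the inverse
of the Gram matrix. -/
def inverseGram {ι : Type*} [Fintype ι] [DecidableEq ι] (p : M)
    (b : Module.Basis ι ℝ (TangentSpace 𝓘(ℝ, E) p)) : Matrix ι ι ℝ :=
  (Matrix.of fun i j ↦ h.inner p (b i) (b j))⁻¹

/-- The full metric contraction `tr_{(1,5)(2,6)(3,7)(4,8)} (R ⊗ R)`, computed in a basis:
`h^{i i'} h^{j j'} h^{k k'} h^{l l'} R_{i j k l} R_{i' j' k' l'}`. -/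
def fullContraction {ι : Type*} [Fintype ι] [DecidableEq ι] (p : M)
    (b : Module.Basis ι ℝ (TangentSpace 𝓘(ℝ, E) p)) : ℝ :=
  ∑ i, ∑ j, ∑ k, ∑ l, ∑ i', ∑ j', ∑ k', ∑ l',
    h.inverseGram p b i i' * h.inverseGram p b j j' * h.inverseGram p b k k'
      * h.inverseGram p b l l'
      * h.curvature₄ p (b i) (b j) (b k) (b l) * h.curvature₄ p (b i') (b j') (b k') (b l')

/-- The squared norm `‖R‖²` of the curvature tensor at `p`. The contraction does not depend on the
basis; some basis of the tangent space is used. -/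
def curvatureNormSq [FiniteDimensional ℝ E] (p : M) : ℝ :=
  h.fullContraction p (Module.finBasis ℝ E : Module.Basis _ ℝ (TangentSpace 𝓘(ℝ, E) p))

end LorentzianMetric

end

/-! The equivalence holds point by point. A parallel field satisfies `R(U,V)X = 0`; pair symmetry
and antisymmetry of `R` then make `R` vanish as soon as any one argument is `X`. Complete `X` by a
null vector `Z` with `h(X,Z) = 1` and an orthonormal family `e` of the positive definite space
`{X,Z}^⊥`. The inverse metric is `∑ e_a ⊗ e_a + X ⊗ Z + Z ⊗ X`, and each mixed term puts an `X` into
one factor of `R ⊗ R`, so `‖R‖²` is the sum of the squares of `R(e_a,e_b,e_c,e_d)`. It is zero iff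
all these components are. Since `Ξ^⊥` is spanned by `X` and the `e_a`, and `R(u,v)w` never has a
`Z`-component, this says exactly that `R(u,v)w` is a multiple of `X` for `u,v,w` in `Ξ^⊥`. The
contraction is `sum_inv_gram_mul_mul_eq_sum_sq`; the curvature inputs are
`coordCurvatureLower_pair_comm` and `coordCurvatureLower_of_isParallel`, both computed at the centre
of a chart. -/

/-! ### Linear algebra: adapted null frames and metric contractions. -/

section LinearAlgebra

open scoped Matrix

variable {V : Type*} [AddCommGroup V] [Module ℝ V]

/-- If the orthogonal complement of some vector is positive definite, every nonzero null vector `X`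
is completed by a dual null vector `Z` and an orthonormal family orthogonal to `X`, which together
span the space. -/
theorem exists_adaptedFamily [FiniteDimensional ℝ V] (g : LinearMap.BilinForm ℝ V) (hg : g.IsSymm)
    (t : V) (hpos : ∀ v, g t v = 0 → v ≠ 0 → 0 < g v v)
    (X : V) (hX : X ≠ 0) (hXX : g X X = 0) :
    ∃ (n : ℕ) (e : Fin n → V) (Z : V), (∀ a, g (e a) X = 0) ∧
      ∀ x, x = ∑ a, g x (e a) • e a + g x Z • X + g x X • Z := by
  have hs : ∀ x y, g x y = g y x := fun x y ↦ hg.eq x y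
  have htX : g t X ≠ 0 := fun h0 ↦ (hpos X h0 hX).ne' hXX
  set α := (g t X)⁻¹ with hα
  have hα1 : α * g t X = 1 := inv_mul_cancel₀ htX
  -- The factor `α` gives `g Z X = 1`; the multiple of `X` is chosen to cancel `g (α • t) (α • t)`,
  -- making `Z` null.
  set Z : V := α • t + (-(α ^ 2 * g t t) / 2) • X with hZ
  have hZX : g Z X = 1 := by simp [hZ, hXX, hα1]
  have hZZ : g Z Z = 0 := by
    have : g X t = g t X := hs _ _
    simp only [hZ, map_add, map_smul, LinearMap.add_apply, LinearMap.smul_apply, smul_eq_mul, hXX,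
      this]
    linear_combination (-(α ^ 2 * g t t)) * hα1
  let W : Submodule ℝ V := LinearMap.ker (g X) ⊓ LinearMap.ker (g Z)
  have hWX : ∀ w ∈ W, g w X = 0 := fun w hw ↦ by rw [hs]; exact hw.1
  have hα0 : α ≠ 0 := inv_ne_zero htX
  -- `t` is a combination of `X` and `Z`, so `W` lies in the complement of `t` and inherits positive
  -- definiteness.
  have hWt : ∀ w ∈ W, g t w = 0 := fun w hw ↦ by
    have h1 : g X w = 0 := hw.1
    have h2 : g Z w = 0 := hw.2
    simp only [hZ, map_add, map_smul, LinearMap.add_apply, LinearMap.smul_apply, smul_eq_mul, h1,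
      mul_zero, add_zero] at h2
    exact (mul_eq_zero.1 h2).resolve_left hα0
  have hWpos : ∀ w ∈ W, w ≠ 0 → 0 < g w w := fun w hw ↦ hpos w (hWt w hw)
  have hrs : LinearMap.IsSymm (g.restrict W) := ⟨fun x y ↦ hs _ _⟩
  obtain ⟨v, hv⟩ := LinearMap.BilinForm.exists_orthogonal_basis hrs
  have hvpos : ∀ a, 0 < g (v a) (v a) := fun a ↦
    hWpos _ (v a).2 (by simpa using v.ne_zero a)
  have hvo : ∀ a b, a ≠ b → g (v a) (v b) = 0 := fun a b hab ↦ hv hab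
  refine ⟨_, fun a ↦ (√(g (v a) (v a)))⁻¹ • (v a : V), Z, fun a ↦ ?_, fun x ↦ ?_⟩
  · simp [hWX _ (v a).2]
  · have key : ∀ w ∈ W, w = ∑ a, (g w (v a) / g (v a) (v a)) • (v a : V) := by
      intro w hw
      have hr := v.sum_repr ⟨w, hw⟩
      have hr' : w = ∑ a, v.repr ⟨w, hw⟩ a • (v a : V) := by
        have h2 := congrArg W.subtype hr
        rw [map_sum] at h2
        exact h2.symm
      conv_lhs => rw [hr']
      refine Finset.sum_congr rfl fun a _ ↦ ?_
      congr 1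
      rw [eq_div_iff (hvpos a).ne']
      conv_rhs => rw [hr']
      rw [map_sum, LinearMap.sum_apply, Finset.sum_eq_single a]
      · simp
      · intro b _ hb
        simp [hvo b a hb]
      · simp
    have hxW : x - g x Z • X - g x X • Z ∈ W := by
      have h1 : g X Z = 1 := by rw [hs, hZX]
      constructor
      · simp [hXX, h1, hs X x]
      · simp [hZX, hZZ, hs Z x]
    have hk := key _ hxW
    have hsum : ∑ a, (g (x - g x Z • X - g x X • Z) (v a) / g (v a) (v a)) • (v a : V) =
        ∑ a, g x ((√(g (v a) (v a)))⁻¹ • (v a : V)) • (√(g (v a) (v a)))⁻¹ • (v a : V) := by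
      refine Finset.sum_congr rfl fun a _ ↦ ?_
      have e1 : g X (v a) = 0 := (v a).2.1
      have e2 : g Z (v a) = 0 := (v a).2.2
      rw [smul_smul]
      congr 1
      have := Real.mul_self_sqrt (hvpos a).le
      simp only [map_sub, map_smul, LinearMap.sub_apply, LinearMap.smul_apply, e1, e2, smul_eq_mul,
        mul_zero, sub_zero]
      rw [div_eq_mul_inv, ← congrArg Inv.inv this, mul_inv]
      ring
    rw [hsum] at hk
    rw [← hk]
    abel

/-- The metric trace of a bilinear map which vanishes on the null direction, computed in an
arbitrary basis, is its trace over an adapted orthonormal family. -/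
theorem sum_inv_gram_mul {ι κ : Type*} [Fintype ι] [DecidableEq ι] [Fintype κ]
    (g : LinearMap.BilinForm ℝ V) (hg : g.IsSymm) {X Z : V} {e : κ → V}
    (he : ∀ x, x = ∑ a, g x (e a) • e a + g x Z • X + g x X • Z)
    (hnd : ∀ x, (∀ y, g x y = 0) → x = 0)
    (b : Module.Basis ι ℝ V) (f : V → V → ℝ)
    (hf₁ : ∀ y, IsLinearMap ℝ (fun x ↦ f x y)) (hf₂ : ∀ x, IsLinearMap ℝ (f x))
    (hX₁ : ∀ y, f X y = 0) (hX₂ : ∀ x, f x X = 0) :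
    ∑ i, ∑ i', (Matrix.of fun i j ↦ g (b i) (b j))⁻¹ i i' * f (b i) (b i') =
      ∑ a, f (e a) (e a) := by
  set G : Matrix ι ι ℝ := Matrix.of fun i j ↦ g (b i) (b j) with hG
  -- A kernel vector of the Gram matrix would be the coordinates of a vector in the radical of `g`.
  have hGu : IsUnit G.det := by
    have hdet : G.det ≠ 0 := by
      intro h0
      obtain ⟨c, hc0, hc⟩ := Matrix.exists_vecMul_eq_zero_iff.2 h0
      apply hc0
      have hz : ∑ i, c i • b i = 0 := by
        apply hnd
        intro y
        have hb : ∀ j, g (∑ i, c i • b i) (b j) = 0 := by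
          intro j
          have := congrFun hc j
          simpa [Matrix.vecMul, dotProduct, hG, LinearMap.sum_apply] using this
        have : g (∑ i, c i • b i) = 0 := b.ext fun j ↦ by simpa using hb j
        rw [this]; rfl
      funext i
      exact Fintype.linearIndependent_iff.1 b.linearIndependent c hz i
    exact hdet.isUnit
  have hGG : G⁻¹ᵀ * G = 1 := by
    have hGt : Gᵀ = G := by ext i j; exact hg.eq _ _
    rw [Matrix.transpose_nonsing_inv, hGt, Matrix.nonsing_inv_mul _ hGu]
  -- Raising the index of the covector `g · d` gives back `d`.
  have hdual : ∀ d : V, ∑ i', (∑ i, G⁻¹ i i' * g (b i) d) • b i' = d := by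
    intro d
    conv_rhs => rw [← b.sum_repr d]
    refine Finset.sum_congr rfl fun i' _ ↦ ?_
    congr 1
    calc ∑ i, G⁻¹ i i' * g (b i) d = ∑ i, G⁻¹ i i' * ∑ k, b.repr d k * G i k := by
          refine Finset.sum_congr rfl fun i _ ↦ ?_
          have h1 := congrArg (g (b i)) (b.sum_repr d)
          rw [← h1, map_sum]
          simp [hG]
      _ = ∑ k, b.repr d k * (G⁻¹ᵀ * G) i' k := by
          simp only [Matrix.mul_apply, Finset.mul_sum, Matrix.transpose_apply]
          rw [Finset.sum_comm]
          exact Finset.sum_congr rfl fun _ _ ↦ Finset.sum_congr rfl fun _ _ ↦ by ring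
      _ = b.repr d i' := by simp [hGG, Matrix.one_apply]
  have expand : ∀ x y, f x y = ∑ a, g x (e a) * f (e a) y + g x X * f Z y := by
    intro x y
    have h1 := congrArg ((hf₁ y).mk' _) (he x)
    simpa only [map_add, map_sum, map_smul, IsLinearMap.mk'_apply, hX₁, smul_eq_mul, mul_zero,
      add_zero] using h1
  have hsum : ∀ u d : V, ∑ i, ∑ i', G⁻¹ i i' * (g (b i) d * f u (b i')) = f u d := by
    intro u d
    have h1 : f u d = (hf₂ u).mk' _ d := rfl
    rw [h1]
    conv_rhs => rw [← hdual d]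
    rw [Finset.sum_comm, map_sum]
    refine Finset.sum_congr rfl fun i' _ ↦ ?_
    rw [map_smul, smul_eq_mul, Finset.sum_mul]
    refine Finset.sum_congr rfl fun i _ ↦ ?_
    rw [IsLinearMap.mk'_apply]; ring
  -- By `hsum` the `Z` term of the expansion contracts to `f Z X`, which is zero.
  calc ∑ i, ∑ i', G⁻¹ i i' * f (b i) (b i')
      = ∑ a, ∑ i, ∑ i', G⁻¹ i i' * (g (b i) (e a) * f (e a) (b i'))
        + ∑ i, ∑ i', G⁻¹ i i' * (g (b i) X * f Z (b i')) := by
        rw [Finset.sum_comm (s := (Finset.univ : Finset κ)), ← Finset.sum_add_distrib]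
        refine Finset.sum_congr rfl fun i _ ↦ ?_
        rw [Finset.sum_comm (s := (Finset.univ : Finset κ)), ← Finset.sum_add_distrib]
        refine Finset.sum_congr rfl fun i' _ ↦ ?_
        rw [expand, mul_add, Finset.mul_sum]
    _ = ∑ a, f (e a) (e a) := by simp only [hsum, hX₂, add_zero]

/-- The full metric contraction of `R ⊗ R`, for a `4`-linear map `R` vanishing on the null
direction in each slot, is the sum of the squares of the components in an adapted orthonormal
family. -/
theorem sum_inv_gram_mul_mul_eq_sum_sq {ι κ : Type*} [Fintype ι] [DecidableEq ι] [Fintype κ]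
    (g : LinearMap.BilinForm ℝ V) (hg : g.IsSymm) {X Z : V} {e : κ → V}
    (he : ∀ x, x = ∑ a, g x (e a) • e a + g x Z • X + g x X • Z)
    (hnd : ∀ x, (∀ y, g x y = 0) → x = 0)
    (b : Module.Basis ι ℝ V) (R : V → V → V → V → ℝ)
    (h₁ : ∀ v w z, IsLinearMap ℝ (fun u ↦ R u v w z))
    (h₂ : ∀ u w z, IsLinearMap ℝ (fun v ↦ R u v w z))
    (h₃ : ∀ u v z, IsLinearMap ℝ (fun w ↦ R u v w z))
    (h₄ : ∀ u v w, IsLinearMap ℝ (fun z ↦ R u v w z))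
    (hX₁ : ∀ v w z, R X v w z = 0) (hX₂ : ∀ u w z, R u X w z = 0)
    (hX₃ : ∀ u v z, R u v X z = 0) (hX₄ : ∀ u v w, R u v w X = 0)
    (G : Matrix ι ι ℝ) (hG : G = (Matrix.of fun i j ↦ g (b i) (b j))⁻¹) :
    ∑ i, ∑ j, ∑ k, ∑ l, ∑ i', ∑ j', ∑ k', ∑ l', G i i' * G j j' * G k k' * G l l'
      * R (b i) (b j) (b k) (b l) * R (b i') (b j') (b k') (b l') =
    ∑ a, ∑ a', ∑ a'', ∑ a''', R (e a) (e a') (e a'') (e a''') ^ 2 := by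
  have tr := fun f ↦ sum_inv_gram_mul g hg he hnd b f
  rw [← hG] at tr
  -- The index pairs are contracted one at a time, from the last slot to the first. The remaining
  -- arguments of the two factors stay independent, because their indices are not yet paired.
  have t₄ : ∀ u v w u' v' w', ∑ i, ∑ i', G i i' * (R u v w (b i) * R u' v' w' (b i')) =
      ∑ a, R u v w (e a) * R u' v' w' (e a) := fun u v w u' v' w' ↦
    tr (fun x y ↦ R u v w x * R u' v' w' y)
      (fun y ↦ ⟨fun x x' ↦ by simp [(h₄ u v w).map_add, add_mul],
        fun c x ↦ by simp [(h₄ u v w).map_smul, mul_assoc]⟩)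
      (fun x ↦ ⟨fun y y' ↦ by simp [(h₄ u' v' w').map_add, mul_add],
        fun c y ↦ by simp [(h₄ u' v' w').map_smul, mul_left_comm]⟩)
      (fun y ↦ by simp [hX₄]) (fun y ↦ by simp [hX₄])
  have t₃ : ∀ u v u' v', ∑ i, ∑ i', G i i' * ∑ a, R u v (b i) (e a) * R u' v' (b i') (e a) =
      ∑ c, ∑ a, R u v (e c) (e a) * R u' v' (e c) (e a) := fun u v u' v' ↦
    tr (fun x y ↦ ∑ a, R u v x (e a) * R u' v' y (e a))
      (fun y ↦ ⟨fun x x' ↦ by simp [(h₃ u v _).map_add, add_mul, Finset.sum_add_distrib],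
        fun c x ↦ by simp [(h₃ u v _).map_smul, mul_assoc, Finset.mul_sum]⟩)
      (fun x ↦ ⟨fun y y' ↦ by simp [(h₃ u' v' _).map_add, mul_add, Finset.sum_add_distrib],
        fun c y ↦ by simp [(h₃ u' v' _).map_smul, mul_left_comm, Finset.mul_sum]⟩)
      (fun y ↦ by simp [hX₃]) (fun y ↦ by simp [hX₃])
  have t₂ : ∀ u u', ∑ i, ∑ i', G i i' *
      ∑ c, ∑ a, R u (b i) (e c) (e a) * R u' (b i') (e c) (e a) =
      ∑ d, ∑ c, ∑ a, R u (e d) (e c) (e a) * R u' (e d) (e c) (e a) := fun u u' ↦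
    tr (fun x y ↦ ∑ c, ∑ a, R u x (e c) (e a) * R u' y (e c) (e a))
      (fun y ↦ ⟨fun x x' ↦ by simp [(h₂ u _ _).map_add, add_mul, Finset.sum_add_distrib],
        fun c x ↦ by simp [(h₂ u _ _).map_smul, mul_assoc, Finset.mul_sum]⟩)
      (fun x ↦ ⟨fun y y' ↦ by simp [(h₂ u' _ _).map_add, mul_add, Finset.sum_add_distrib],
        fun c y ↦ by simp [(h₂ u' _ _).map_smul, mul_left_comm, Finset.mul_sum]⟩)
      (fun y ↦ by simp [hX₂]) (fun y ↦ by simp [hX₂])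
  have t₁ : ∑ i, ∑ i', G i i' *
      ∑ d, ∑ c, ∑ a, R (b i) (e d) (e c) (e a) * R (b i') (e d) (e c) (e a) =
      ∑ f, ∑ d, ∑ c, ∑ a, R (e f) (e d) (e c) (e a) * R (e f) (e d) (e c) (e a) :=
    tr (fun x y ↦ ∑ d, ∑ c, ∑ a, R x (e d) (e c) (e a) * R y (e d) (e c) (e a))
      (fun y ↦ ⟨fun x x' ↦ by simp [(h₁ _ _ _).map_add, add_mul, Finset.sum_add_distrib],
        fun c x ↦ by simp [(h₁ _ _ _).map_smul, mul_assoc, Finset.mul_sum]⟩)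
      (fun x ↦ ⟨fun y y' ↦ by simp [(h₁ _ _ _).map_add, mul_add, Finset.sum_add_distrib],
        fun c y ↦ by simp [(h₁ _ _ _).map_smul, mul_left_comm, Finset.mul_sum]⟩)
      (fun y ↦ by simp [hX₁]) (fun y ↦ by simp [hX₁])
  -- Each primed sum is moved next to its unprimed partner.
  have shuffle : ∀ F : ι → ι → ι → ι → ι → ι → ι → ι → ℝ,
      ∑ i, ∑ j, ∑ k, ∑ l, ∑ i', ∑ j', ∑ k', ∑ l', F i j k l i' j' k' l' =
      ∑ i, ∑ i', ∑ j, ∑ j', ∑ k, ∑ k', ∑ l, ∑ l', F i j k l i' j' k' l' := by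
    have s₂ : ∀ H : ι → ι → ι → ℝ, ∑ k, ∑ l, ∑ i, H k l i = ∑ i, ∑ k, ∑ l, H k l i := fun H ↦ by
      rw [Finset.sum_comm]
      exact (Finset.sum_congr rfl fun _ _ ↦ Finset.sum_comm).trans
        (Finset.sum_comm.trans (Finset.sum_congr rfl fun _ _ ↦ Finset.sum_comm))
    have s₃ : ∀ H : ι → ι → ι → ι → ℝ,
        ∑ j, ∑ k, ∑ l, ∑ i, H j k l i = ∑ i, ∑ j, ∑ k, ∑ l, H j k l i := fun H ↦
      (Finset.sum_congr rfl fun _ _ ↦ s₂ _).trans Finset.sum_comm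
    intro F
    refine Finset.sum_congr rfl fun i _ ↦ (s₃ _).trans (Finset.sum_congr rfl fun i' _ ↦
      Finset.sum_congr rfl fun j _ ↦ (s₂ _).trans (Finset.sum_congr rfl fun j' _ ↦
      Finset.sum_congr rfl fun k _ ↦ Finset.sum_comm))
  rw [shuffle]
  simp only [sq]
  rw [← t₁]
  refine Finset.sum_congr rfl fun i _ ↦ Finset.sum_congr rfl fun i' _ ↦ ?_
  rw [← t₂]
  simp only [Finset.mul_sum (a := G i i')]
  refine Finset.sum_congr rfl fun j _ ↦ Finset.sum_congr rfl fun j' _ ↦ ?_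
  rw [← t₃]
  simp only [Finset.mul_sum (a := G j j'), Finset.mul_sum (a := G i i')]
  refine Finset.sum_congr rfl fun k _ ↦ Finset.sum_congr rfl fun k' _ ↦ ?_
  rw [← t₄]
  simp only [Finset.mul_sum]
  refine Finset.sum_congr rfl fun l _ ↦ Finset.sum_congr rfl fun l' _ ↦ ?_
  ring

end LinearAlgebra

/-! ### Smoothness and nondegeneracy of the metric in a chart. -/

section

variable {E : Type*} [NormedAddCommGroup E] [NormedSpace ℝ E]
  {M : Type*} [TopologicalSpace M] [ChartedSpace E M]

theorem ContMDiffAt.contDiffAt_comp_extChartAt_symm {F : Type*} [NormedAddCommGroup F]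
    [NormedSpace ℝ F] {f : M → F} {p : M} (hf : ContMDiffAt 𝓘(ℝ, E) 𝓘(ℝ, F) ∞ f p) :
    ContDiffAt ℝ ∞ (fun y ↦ f ((extChartAt 𝓘(ℝ, E) p).symm y)) (extChartAt 𝓘(ℝ, E) p p) := by
  have := (contMDiffAt_iff.1 hf).2
  simpa [Function.comp_def, contDiffWithinAt_univ, chartAt_self_eq] using this

theorem eventually_symm_mem_chartAt_source (p : M) :
    ∀ᶠ y in nhds (extChartAt 𝓘(ℝ, E) p p),
      (extChartAt 𝓘(ℝ, E) p).symm y ∈ (chartAt E p).source := by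
  filter_upwards [extChartAt_target_mem_nhds (I := 𝓘(ℝ, E)) p] with y hy
  simpa using (extChartAt 𝓘(ℝ, E) p).map_target hy

variable [IsManifold 𝓘(ℝ, E) ∞ M]

theorem coordFrame_coordComponents (p q : M) (hq : q ∈ (chartAt E p).source)
    (u : TangentSpace 𝓘(ℝ, E) q) : coordFrame p q (coordComponents p q u) = u :=
  Bundle.Trivialization.symmL_continuousLinearMapAt _ (by simpa using hq) u

theorem coordComponents_coordFrame (p q : M) (hq : q ∈ (chartAt E p).source) (a : E) :
    coordComponents p q (coordFrame p q a) = a :=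
  Bundle.Trivialization.continuousLinearMapAt_symmL _ (by simpa using hq) a

theorem contDiffAt_coordField {X : ∀ x : M, TangentSpace 𝓘(ℝ, E) x}
    (hX : ContMDiff 𝓘(ℝ, E) 𝓘(ℝ, E).tangent ∞
      (fun x ↦ (⟨x, X x⟩ : TangentBundle 𝓘(ℝ, E) M))) (p : M) :
    ContDiffAt ℝ ∞ (coordField X p) (extChartAt 𝓘(ℝ, E) p p) := by
  have h1 := (Bundle.contMDiffAt_section p).1 (hX p)
  refine h1.contDiffAt_comp_extChartAt_symm.congr_of_eventuallyEq ?_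
  filter_upwards [eventually_symm_mem_chartAt_source p] with y hy
  rw [coordField, coordComponents, Bundle.Trivialization.continuousLinearMapAt_apply,
    Bundle.Trivialization.coe_linearMapAt_of_mem _ (by simpa using hy)]

namespace LorentzianMetric

variable (h : LorentzianMetric E M)

theorem coord_apply (p : M) (y a b : E) : h.coord p y a b =
    h.inner ((extChartAt 𝓘(ℝ, E) p).symm y) (coordFrame p ((extChartAt 𝓘(ℝ, E) p).symm y) a)
      (coordFrame p ((extChartAt 𝓘(ℝ, E) p).symm y) b) := rfl

theorem coord_symm (p : M) (y a b : E) : h.coord p y a b = h.coord p y b a :=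
  h.symm _ _ _

theorem contDiffAt_coord (p : M) : ContDiffAt ℝ ∞ (h.coord p) (extChartAt 𝓘(ℝ, E) p p) := by
  have h1 := ((contMDiffAt_hom_bundle _).1 (h.contMDiff p)).2
  refine h1.contDiffAt_comp_extChartAt_symm.congr_of_eventuallyEq ?_
  filter_upwards [eventually_symm_mem_chartAt_source p] with y hy
  ext a b
  have hy' : (extChartAt 𝓘(ℝ, E) p).symm y ∈
      (trivializationAt E (TangentSpace 𝓘(ℝ, E) : M → Type _) p).baseSet := by simpa using hy
  rw [inCoordinates_apply_eq₂ hy' hy' (Set.mem_univ _)]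
  simp only [Bundle.Trivial.fiberBundle_trivializationAt', Bundle.Trivial.linearMapAt_trivialization,
    LinearMap.id_coe, id_eq]
  rw [coord_apply, coordFrame, Bundle.Trivialization.symmL_apply _ hy',
    Bundle.Trivialization.symmL_apply _ hy']

theorem eq_zero_of_inner_eq_zero (x : M) (v : TangentSpace 𝓘(ℝ, E) x)
    (hv : ∀ w, h.inner x v w = 0) : v = 0 := by
  obtain ⟨t, -, ht⟩ := h.lorentzian x
  by_contra h0
  exact (ht v (by rw [h.symm, hv]) h0).ne' (hv v)

/-- Nondegeneracy gives injectivity, and `E` and its dual have equal dimension. Invertibility near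
the centre, not only at it, is needed: `inverse` takes a default value elsewhere, and the
Christoffel symbols must be differentiated. -/
theorem eventually_isInvertible_coord [FiniteDimensional ℝ E] (p : M) :
    ∀ᶠ y in nhds (extChartAt 𝓘(ℝ, E) p p), (h.coord p y).IsInvertible := by
  filter_upwards [eventually_symm_mem_chartAt_source p] with y hy
  set q := (extChartAt 𝓘(ℝ, E) p).symm y with hq
  have hinj : Function.Injective (h.coord p y) := by
    rw [injective_iff_map_eq_zero]
    intro a ha
    have h0 : coordFrame p q a = 0 := by
      refine h.eq_zero_of_inner_eq_zero q _ fun w ↦ ?_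
      rw [← coordFrame_coordComponents p q hy w]
      exact DFunLike.congr_fun ha _
    rw [← coordComponents_coordFrame p q hy a, h0, map_zero]
  have hrank : Module.finrank ℝ E = Module.finrank ℝ (E →L[ℝ] ℝ) := by
    rw [← LinearEquiv.finrank_eq (LinearMap.toContinuousLinearMap : (E →ₗ[ℝ] ℝ) ≃ₗ[ℝ] _)]
    exact (Subspace.dual_finrank_eq).symm
  exact ⟨(LinearEquiv.ofInjectiveOfFinrankEq (h.coord p y : E →ₗ[ℝ] _) hinj
    hrank).toContinuousLinearEquiv, by ext; rfl⟩

end LorentzianMetric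
end

/-! ### Curvature identities in coordinates. -/

noncomputable section

variable {E : Type*} [NormedAddCommGroup E] [NormedSpace ℝ E]
  {M : Type*} [TopologicalSpace M] [ChartedSpace E M] [IsManifold 𝓘(ℝ, E) ∞ M]

local instance : NormedAddCommGroup (E →L[ℝ] E →L[ℝ] ℝ) :=
  ContinuousLinearMap.toNormedAddCommGroup

local instance : NormedSpace ℝ (E →L[ℝ] E →L[ℝ] ℝ) :=
  ContinuousLinearMap.toNormedSpace

local instance : NormedAddCommGroup (E →L[ℝ] E →L[ℝ] E →L[ℝ] ℝ) :=
  ContinuousLinearMap.toNormedAddCommGroup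

local instance : NormedSpace ℝ (E →L[ℝ] E →L[ℝ] E →L[ℝ] ℝ) :=
  ContinuousLinearMap.toNormedSpace

namespace LorentzianMetric

variable (h : LorentzianMetric E M)

theorem christoffelLower_apply (p : M) (y u v z : E) :
    h.christoffelLower p y u v z = 1 / 2 * (fderiv ℝ (h.coord p) y u v z
      + fderiv ℝ (h.coord p) y v u z - fderiv ℝ (h.coord p) y z u v) := rfl

/-- `fderiv` commutes with the flip isometry, so no differentiability at `y` is required. -/
theorem fderiv_coord_symm (p : M) (y u a b : E) :
    fderiv ℝ (h.coord p) y u a b = fderiv ℝ (h.coord p) y u b a := by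
  let iso : (E →L[ℝ] E →L[ℝ] ℝ) ≃ₗᵢ[ℝ] (E →L[ℝ] E →L[ℝ] ℝ) :=
    ContinuousLinearMap.flipₗᵢ ℝ E E ℝ
  have h1 : h.coord p = iso ∘ h.coord p := by
    funext y; ext a b; exact h.coord_symm p y a b
  conv_lhs => rw [h1, iso.comp_fderiv]
  rfl

theorem fderiv_fderiv_coord_symm (p : M) (y u v a b : E) :
    fderiv ℝ (fderiv ℝ (h.coord p)) y u v a b = fderiv ℝ (fderiv ℝ (h.coord p)) y u v b a := by
  let iso : (E →L[ℝ] E →L[ℝ] E →L[ℝ] ℝ) ≃L[ℝ] (E →L[ℝ] E →L[ℝ] E →L[ℝ] ℝ) :=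
    (ContinuousLinearEquiv.refl ℝ E).arrowCongr
      (ContinuousLinearMap.flipₗᵢ ℝ E E ℝ).toContinuousLinearEquiv
  have h1 : fderiv ℝ (h.coord p) = iso ∘ fderiv ℝ (h.coord p) := by
    funext y; ext u a b; exact h.fderiv_coord_symm p y u a b
  conv_lhs => rw [h1, iso.comp_fderiv]
  rfl

theorem fderiv_fderiv_coord_comm (p : M) (u v : E) :
    fderiv ℝ (fderiv ℝ (h.coord p)) (extChartAt 𝓘(ℝ, E) p p) u v =
      fderiv ℝ (fderiv ℝ (h.coord p)) (extChartAt 𝓘(ℝ, E) p p) v u :=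
  (h.contDiffAt_coord p).isSymmSndFDerivAt (by
    rw [minSmoothness_of_isRCLikeNormedField]; exact WithTop.coe_le_coe.2 le_top) u v

theorem christoffelLower_comm (p : M) (y u v : E) :
    h.christoffelLower p y u v = h.christoffelLower p y v u := by
  ext z
  rw [christoffelLower_apply, christoffelLower_apply, h.fderiv_coord_symm p y z u v]
  ring

theorem christoffel_comm (p : M) (y u v : E) :
    h.christoffel p y u v = h.christoffel p y v u := by
  rw [christoffel, christoffelLower_comm, christoffel]

/-- Compatibility of the connection with the metric. -/
theorem fderiv_coord_eq (p : M) (y u a b : E) :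
    fderiv ℝ (h.coord p) y u a b =
      h.christoffelLower p y u a b + h.christoffelLower p y u b a := by
  simp only [christoffelLower_apply]
  rw [h.fderiv_coord_symm p y u b a, h.fderiv_coord_symm p y b u a,
    h.fderiv_coord_symm p y a u b]
  ring

theorem coord_christoffel {p : M} {y : E} (hy : (h.coord p y).IsInvertible) (u v : E) :
    h.coord p y (h.christoffel p y u v) = h.christoffelLower p y u v :=
  hy.self_apply_inverse _

theorem hasFDerivAt_coord (p : M) :
    HasFDerivAt (h.coord p) (fderiv ℝ (h.coord p) (extChartAt 𝓘(ℝ, E) p p))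
      (extChartAt 𝓘(ℝ, E) p p) :=
  ((h.contDiffAt_coord p).differentiableAt (by simp)).hasFDerivAt

theorem hasFDerivAt_fderiv_coord (p : M) :
    HasFDerivAt (fderiv ℝ (h.coord p)) (fderiv ℝ (fderiv ℝ (h.coord p)) (extChartAt 𝓘(ℝ, E) p p))
      (extChartAt 𝓘(ℝ, E) p p) :=
  (((h.contDiffAt_coord p).fderiv_right (m := 1) (by norm_cast)).differentiableAt
    (by simp)).hasFDerivAt

theorem differentiableAt_christoffelLower (p : M) (u v : E) :
    DifferentiableAt ℝ (fun y ↦ h.christoffelLower p y u v) (extChartAt 𝓘(ℝ, E) p p) := by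
  have h2 := (h.hasFDerivAt_fderiv_coord p).differentiableAt
  have h3 : DifferentiableAt ℝ (fun y ↦ ((fderiv ℝ (h.coord p) y).flip u).flip v)
      (extChartAt 𝓘(ℝ, E) p p) := by
    have a₁ : DifferentiableAt ℝ (fun y ↦ (fderiv ℝ (h.coord p) y).flip)
        (extChartAt 𝓘(ℝ, E) p p) :=
      (ContinuousLinearMap.flipₗᵢ ℝ E E (E →L[ℝ] ℝ)).differentiable.differentiableAt.comp _ h2
    have a₂ : DifferentiableAt ℝ (fun y ↦ (fderiv ℝ (h.coord p) y).flip u)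
        (extChartAt 𝓘(ℝ, E) p p) := a₁.clm_apply (differentiableAt_const u)
    have a₃ : DifferentiableAt ℝ (fun y ↦ ((fderiv ℝ (h.coord p) y).flip u).flip)
        (extChartAt 𝓘(ℝ, E) p p) :=
      (ContinuousLinearMap.flipₗᵢ ℝ E E ℝ).differentiable.differentiableAt.comp _ a₂
    exact a₃.clm_apply (differentiableAt_const v)
  unfold christoffelLower
  exact (((h2.clm_apply (differentiableAt_const u)).clm_apply (differentiableAt_const v)).add
    ((h2.clm_apply (differentiableAt_const v)).clm_apply (differentiableAt_const u))
    |>.sub h3).const_smul (1 / 2 : ℝ)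

theorem fderiv_christoffelLower_apply (p : M) (u v w z : E) :
    fderiv ℝ (fun y ↦ h.christoffelLower p y v w) (extChartAt 𝓘(ℝ, E) p p) u z =
      1 / 2 * (fderiv ℝ (fderiv ℝ (h.coord p)) (extChartAt 𝓘(ℝ, E) p p) u v w z
      + fderiv ℝ (fderiv ℝ (h.coord p)) (extChartAt 𝓘(ℝ, E) p p) u w v z
      - fderiv ℝ (fderiv ℝ (h.coord p)) (extChartAt 𝓘(ℝ, E) p p) u z v w) := by
  have h1 := ((h.differentiableAt_christoffelLower p v w).hasFDerivAt).clm_apply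
    (hasFDerivAt_const z _)
  have d : ∀ a b c : E, HasFDerivAt (fun y ↦ fderiv ℝ (h.coord p) y a b c) _
      (extChartAt 𝓘(ℝ, E) p p) := fun a b c ↦
    (((h.hasFDerivAt_fderiv_coord p).clm_apply (hasFDerivAt_const a _)).clm_apply
      (hasFDerivAt_const b _)).clm_apply (hasFDerivAt_const c _)
  have h2 := (((d v w z).add (d w v z)).sub (d z v w)).const_mul (1 / 2)
  have h3 := DFunLike.congr_fun (h1.unique h2) u
  simpa using h3

theorem differentiableAt_christoffel [FiniteDimensional ℝ E] (p : M) (u v : E) :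
    DifferentiableAt ℝ (fun y ↦ h.christoffel p y u v) (extChartAt 𝓘(ℝ, E) p p) := by
  have := FiniteDimensional.complete ℝ E
  have h1 := ((h.eventually_isInvertible_coord p).self_of_nhds.contDiffAt_map_inverse
    (n := 1)).differentiableAt (by simp)
  exact (h1.comp _ (h.hasFDerivAt_coord p).differentiableAt).clm_apply
    (h.differentiableAt_christoffelLower p u v)

/-- Product rule applied to `h(Γ(v,w), z) = Γ_lower(v,w)(z)` near the centre; this avoids
differentiating the inverse metric explicitly. -/
theorem coord_fderiv_christoffel [FiniteDimensional ℝ E] (p : M) (u v w z : E) :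
    h.coord p (extChartAt 𝓘(ℝ, E) p p)
      (fderiv ℝ (fun y ↦ h.christoffel p y v w) (extChartAt 𝓘(ℝ, E) p p) u) z =
    fderiv ℝ (fun y ↦ h.christoffelLower p y v w) (extChartAt 𝓘(ℝ, E) p p) u z
      - fderiv ℝ (h.coord p) (extChartAt 𝓘(ℝ, E) p p) u
        (h.christoffel p (extChartAt 𝓘(ℝ, E) p p) v w) z := by
  have h1 := ((h.hasFDerivAt_coord p).clm_apply
    (h.differentiableAt_christoffel p v w).hasFDerivAt)
  have h2 := (h.differentiableAt_christoffelLower p v w).hasFDerivAt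
  have h3 := h1.unique (h2.congr_of_eventuallyEq
    ((h.eventually_isInvertible_coord p).mono fun y hy ↦ h.coord_christoffel hy v w))
  have h4 := DFunLike.congr_fun (DFunLike.congr_fun h3 u) z
  generalize extChartAt 𝓘(ℝ, E) p p = y₀ at h4 ⊢
  simp at h4
  linarith

/-- The curvature with lowered index in terms of derivatives of Christoffel symbols of the first
kind. -/
theorem coord_coordCurvature [FiniteDimensional ℝ E] (p : M) (u v w z : E) :
    h.coord p (extChartAt 𝓘(ℝ, E) p p) (h.coordCurvature p (extChartAt 𝓘(ℝ, E) p p) u v w) z =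
      fderiv ℝ (fun y ↦ h.christoffelLower p y v w) (extChartAt 𝓘(ℝ, E) p p) u z
      - fderiv ℝ (fun y ↦ h.christoffelLower p y u w) (extChartAt 𝓘(ℝ, E) p p) v z
      - h.christoffelLower p (extChartAt 𝓘(ℝ, E) p p) u z
        (h.christoffel p (extChartAt 𝓘(ℝ, E) p p) v w)
      + h.christoffelLower p (extChartAt 𝓘(ℝ, E) p p) v z
        (h.christoffel p (extChartAt 𝓘(ℝ, E) p p) u w) := by
  have hi := (h.eventually_isInvertible_coord p).self_of_nhds
  rw [coordCurvature]
  simp only [map_add, map_sub, add_apply, sub_apply,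
    coord_fderiv_christoffel, h.coord_christoffel hi, h.fderiv_coord_eq]
  ring

/-- The components `R(u, v, w, z)` of the curvature at the centre `p` of the chart around `p`. -/
def coordCurvatureLower (p : M) (u v w z : E) : ℝ :=
  h.coord p (extChartAt 𝓘(ℝ, E) p p) (h.coordCurvature p (extChartAt 𝓘(ℝ, E) p p) u v w) z

theorem coordCurvatureLower_neg_left (p : M) (u v w z : E) :
    h.coordCurvatureLower p v u w z = - h.coordCurvatureLower p u v w z := by
  simp only [coordCurvatureLower, coordCurvature, map_add, map_sub, add_apply,
    sub_apply]
  ring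

/-- The quadratic terms are products `h(Γ(a,b), Γ(c,d))`, symmetric in the two pairs. The second
derivatives of `h` match by the symmetry of `h` and of second derivatives, so the Bianchi identity
is not needed. -/
theorem coordCurvatureLower_pair_comm [FiniteDimensional ℝ E] (p : M) (u v w z : E) :
    h.coordCurvatureLower p w z u v = h.coordCurvatureLower p u v w z := by
  have hi := (h.eventually_isInvertible_coord p).self_of_nhds
  have key : ∀ a b c d : E, h.christoffelLower p (extChartAt 𝓘(ℝ, E) p p) a b
      (h.christoffel p (extChartAt 𝓘(ℝ, E) p p) c d) =
      h.christoffelLower p (extChartAt 𝓘(ℝ, E) p p) c d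
      (h.christoffel p (extChartAt 𝓘(ℝ, E) p p) a b) := fun a b c d ↦ by
    rw [← h.coord_christoffel hi, ← h.coord_christoffel hi, h.coord_symm]
  simp only [coordCurvatureLower, coord_coordCurvature, fderiv_christoffelLower_apply]
  rw [key w v, h.christoffelLower_comm p _ z u, h.christoffel_comm p _ w v,
    h.christoffelLower_comm p _ z v, h.christoffel_comm p _ w u]
  have s := h.fderiv_fderiv_coord_symm p (extChartAt 𝓘(ℝ, E) p p)
  have c := fun a b x y ↦ DFunLike.congr_fun (DFunLike.congr_fun
    (h.fderiv_fderiv_coord_comm p a b) x) y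
  linarith [c w z u v, c u v w z, c w u z v, s u w z v, c w v z u, s v w z u, c z u w v, s u z w v,
    c z v w u, s v z w u]

/-- The curvature annihilates a parallel vector field. -/
theorem coordCurvatureLower_of_isParallel [FiniteDimensional ℝ E]
    {X : ∀ x : M, TangentSpace 𝓘(ℝ, E) x}
    (hX : ContMDiff 𝓘(ℝ, E) 𝓘(ℝ, E).tangent ∞
      (fun x ↦ (⟨x, X x⟩ : TangentBundle 𝓘(ℝ, E) M))) (hp : h.IsParallel X)
    (p : M) (u v z : E) :
    h.coordCurvatureLower p u v (coordField X p (extChartAt 𝓘(ℝ, E) p p)) z = 0 := by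
  have hF := contDiffAt_coordField hX p
  have hF1 := (hF.differentiableAt (by simp)).hasFDerivAt
  have hF2 := ((hF.fderiv_right (m := 1) (by norm_cast)).differentiableAt (by simp)).hasFDerivAt
  have hsymm : ∀ u v, fderiv ℝ (fderiv ℝ (coordField X p)) (extChartAt 𝓘(ℝ, E) p p) u v =
      fderiv ℝ (fderiv ℝ (coordField X p)) (extChartAt 𝓘(ℝ, E) p p) v u :=
    hF.isSymmSndFDerivAt (by
    rw [minSmoothness_of_isRCLikeNormedField]; exact WithTop.coe_le_coe.2 le_top)
  have hinv := h.eventually_isInvertible_coord p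
  have hi := hinv.self_of_nhds
  have hpar : ∀ᶠ y in nhds (extChartAt 𝓘(ℝ, E) p p), ∀ v,
      fderiv ℝ (coordField X p) y v = - h.christoffel p y v (coordField X p y) := by
    filter_upwards [extChartAt_target_mem_nhds (I := 𝓘(ℝ, E)) p] with y hy v
    exact eq_neg_of_add_eq_zero_left (hp p y hy v)
  have hpar0 := hpar.self_of_nhds
  -- The parallel equation with its index lowered involves only `X`, `h` and their first
  -- derivatives, so it can be differentiated by the product rule.
  have hlow : ∀ v, (fun y ↦ h.coord p y (fderiv ℝ (coordField X p) y v) z) =ᶠ[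
      nhds (extChartAt 𝓘(ℝ, E) p p)] fun y ↦ -(1 / 2 * (fderiv ℝ (h.coord p) y v (coordField X p y) z
      + fderiv ℝ (h.coord p) y (coordField X p y) v z
      - fderiv ℝ (h.coord p) y z v (coordField X p y))) := fun v ↦ by
    filter_upwards [hpar, hinv] with y hy hy'
    rw [hy, map_neg, h.coord_christoffel hy', neg_apply,
      christoffelLower_apply]
  have hD := h.hasFDerivAt_fderiv_coord p
  have hder : ∀ u v, h.coord p (extChartAt 𝓘(ℝ, E) p p)
      (fderiv ℝ (fderiv ℝ (coordField X p)) (extChartAt 𝓘(ℝ, E) p p) u v) z =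
      h.christoffelLower p (extChartAt 𝓘(ℝ, E) p p) u
        (h.christoffel p (extChartAt 𝓘(ℝ, E) p p) v
          (coordField X p (extChartAt 𝓘(ℝ, E) p p))) z
      + h.christoffelLower p (extChartAt 𝓘(ℝ, E) p p) u z
        (h.christoffel p (extChartAt 𝓘(ℝ, E) p p) v
          (coordField X p (extChartAt 𝓘(ℝ, E) p p)))
      - fderiv ℝ (fun y ↦ h.christoffelLower p y v (coordField X p (extChartAt 𝓘(ℝ, E) p p)))
        (extChartAt 𝓘(ℝ, E) p p) u z
      + h.christoffelLower p (extChartAt 𝓘(ℝ, E) p p) v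
        (h.christoffel p (extChartAt 𝓘(ℝ, E) p p) u
          (coordField X p (extChartAt 𝓘(ℝ, E) p p))) z := by
    intro u v
    have hl := ((h.hasFDerivAt_coord p).clm_apply
      (hF2.clm_apply (hasFDerivAt_const v _))).clm_apply (hasFDerivAt_const z _)
    have hv := hasFDerivAt_const v (extChartAt 𝓘(ℝ, E) p p) (𝕜 := ℝ)
    have hz := hasFDerivAt_const z (extChartAt 𝓘(ℝ, E) p p) (𝕜 := ℝ)
    have hr := (((((hD.clm_apply hv).clm_apply hF1).clm_apply hz).add
      (((hD.clm_apply hF1).clm_apply hv).clm_apply hz)).sub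
      (((hD.clm_apply hz).clm_apply hv).clm_apply hF1)).const_mul (1 / 2) |>.neg
    have he := DFunLike.congr_fun (hl.unique (hr.congr_of_eventuallyEq (hlow v))) u
    rw [← h.fderiv_coord_eq, fderiv_christoffelLower_apply]
    rw [h.christoffelLower_apply p _ v]
    generalize extChartAt 𝓘(ℝ, E) p p = y₀ at he hpar0 ⊢
    simp [hpar0] at he
    linarith
  -- Antisymmetrising in `u, v` removes the second derivative of `X` and the two outer `Γ_lower`
  -- terms; what remains is the curvature applied to `X`.
  have h1 := hder u v
  have h2 := hder v u
  rw [hsymm v u] at h2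
  rw [coordCurvatureLower, coord_coordCurvature]
  linarith

end LorentzianMetric
end

/-! ### The curvature tensor at a point and its norm on a Brinkmann wave. -/

noncomputable section

variable {E : Type*} [NormedAddCommGroup E] [NormedSpace ℝ E]
  {M : Type*} [TopologicalSpace M] [ChartedSpace E M] [IsManifold 𝓘(ℝ, E) ∞ M]

/-- The chart followed by its inverse returns `p` only propositionally; generalising the base point
to `q` allows substitution in the dependent types. -/
theorem coordField_extChartAt (X : ∀ x : M, TangentSpace 𝓘(ℝ, E) x) (p : M) :
    coordField X p (extChartAt 𝓘(ℝ, E) p p) = coordComponents p p (X p) := by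
  have key : ∀ q, q = p → coordComponents p q (X q) = coordComponents p p (X p) := by
    rintro q rfl; rfl
  exact key _ (extChartAt_to_inv (I := 𝓘(ℝ, E)) p)

namespace LorentzianMetric

variable (h : LorentzianMetric E M)

theorem coord_extChartAt (p : M) (a b : E) : h.coord p (extChartAt 𝓘(ℝ, E) p p) a b =
    h.inner p (coordFrame p p a) (coordFrame p p b) := by
  have key : ∀ q, q = p → h.inner q (coordFrame p q a) (coordFrame p q b) =
      h.inner p (coordFrame p p a) (coordFrame p p b) := by
    rintro q rfl; rfl
  exact key _ (extChartAt_to_inv (I := 𝓘(ℝ, E)) p)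

theorem curvature₄_eq (p : M) (u v w z : TangentSpace 𝓘(ℝ, E) p) :
    h.curvature₄ p u v w z = h.coordCurvatureLower p (coordComponents p p u)
      (coordComponents p p v) (coordComponents p p w) (coordComponents p p z) := by
  rw [coordCurvatureLower, coord_extChartAt,
    coordFrame_coordComponents p p (mem_chart_source E p)]
  rfl

theorem curvature₄_neg_left (p : M) (u v w z : TangentSpace 𝓘(ℝ, E) p) :
    h.curvature₄ p v u w z = - h.curvature₄ p u v w z := by
  simp only [curvature₄_eq, ← coordCurvatureLower_neg_left]

theorem isLinearMap_curvature₄ (p : M) (u v w : TangentSpace 𝓘(ℝ, E) p) :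
    IsLinearMap ℝ (fun z ↦ h.curvature₄ p u v w z) :=
  ((h.inner p (h.curvature p u v w) : TangentSpace 𝓘(ℝ, E) p →ₗ[ℝ] ℝ)).isLinear

/-- The metric at `p` as a bilinear form. -/
def bilinForm (p : M) : LinearMap.BilinForm ℝ (TangentSpace 𝓘(ℝ, E) p) :=
  LinearMap.mk₂ ℝ (fun u v ↦ h.inner p u v) (by simp) (by simp) (by simp) (by simp)

variable [FiniteDimensional ℝ E]

theorem curvature₄_pair_comm (p : M) (u v w z : TangentSpace 𝓘(ℝ, E) p) :
    h.curvature₄ p u v w z = h.curvature₄ p w z u v := by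
  simp only [curvature₄_eq, h.coordCurvatureLower_pair_comm p (coordComponents p p u)]

theorem curvature₄_neg_right (p : M) (u v w z : TangentSpace 𝓘(ℝ, E) p) :
    h.curvature₄ p u v z w = - h.curvature₄ p u v w z := by
  rw [curvature₄_pair_comm, curvature₄_neg_left, ← curvature₄_pair_comm]

/-- Linearity is immediate in the last slot only; antisymmetry carries it to the third, and pair
symmetry later to the first two. -/
theorem isLinearMap_curvature₄_third (p : M) (u v z : TangentSpace 𝓘(ℝ, E) p) :
    IsLinearMap ℝ (fun w ↦ h.curvature₄ p u v w z) := by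
  have : (fun w ↦ h.curvature₄ p u v w z) = fun w ↦ - h.curvature₄ p u v z w := by
    funext w; exact h.curvature₄_neg_right p u v z w
  rw [this]
  exact (-(h.isLinearMap_curvature₄ p u v z).mk').isLinear

variable {X : ∀ x : M, TangentSpace 𝓘(ℝ, E) x}

theorem IsBrinkmannWave.curvature₄_third {h : LorentzianMetric E M} (hX : h.IsBrinkmannWave X)
    (p : M) (u v z : TangentSpace 𝓘(ℝ, E) p) : h.curvature₄ p u v (X p) z = 0 := by
  rw [curvature₄_eq, ← coordField_extChartAt]
  exact h.coordCurvatureLower_of_isParallel hX.contMDiff hX.parallel _ _ _ _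

theorem IsBrinkmannWave.curvature₄_fourth {h : LorentzianMetric E M} (hX : h.IsBrinkmannWave X)
    (p : M) (u v w : TangentSpace 𝓘(ℝ, E) p) : h.curvature₄ p u v w (X p) = 0 := by
  rw [curvature₄_neg_right, hX.curvature₄_third, neg_zero]

/-- On a Brinkmann wave there is at each point a family of vectors `e` in `Ξ^⊥` and a vector `Z`
adapted to `X`, and `‖R‖²` is the sum of squares of the components of the curvature along `e`. -/
theorem IsBrinkmannWave.exists_curvatureNormSq_eq {h : LorentzianMetric E M}
    (hX : h.IsBrinkmannWave X) (p : M) :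
    ∃ (n : ℕ) (e : Fin n → TangentSpace 𝓘(ℝ, E) p) (Z : TangentSpace 𝓘(ℝ, E) p),
      (∀ a, h.inner p (e a) (X p) = 0) ∧
      (∀ x, x = ∑ a, h.inner p x (e a) • e a + h.inner p x Z • X p + h.inner p x (X p) • Z) ∧
      h.curvatureNormSq p = ∑ a, ∑ b, ∑ c, ∑ d, h.curvature₄ p (e a) (e b) (e c) (e d) ^ 2 := by
  have hs : (h.bilinForm p).IsSymm := ⟨fun x y ↦ h.symm p x y⟩
  obtain ⟨t, -, ht⟩ := h.lorentzian p
  have : FiniteDimensional ℝ (TangentSpace 𝓘(ℝ, E) p) := ‹FiniteDimensional ℝ E›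
  obtain ⟨n, e, Z, heX, he⟩ := exists_adaptedFamily (h.bilinForm p) hs t ht (X p)
    (hX.lightlike p).1 (hX.lightlike p).2
  refine ⟨n, e, Z, heX, he, ?_⟩
  have h₃ := h.isLinearMap_curvature₄_third p
  have h₄ := h.isLinearMap_curvature₄ p
  have k₃ := hX.curvature₄_third p
  have k₄ := hX.curvature₄_fourth p
  exact sum_inv_gram_mul_mul_eq_sum_sq (h.bilinForm p) hs he (h.eq_zero_of_inner_eq_zero p)
    (Module.finBasis ℝ E : Module.Basis _ ℝ (TangentSpace 𝓘(ℝ, E) p)) (h.curvature₄ p)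
    (fun v w z ↦ by simpa only [h.curvature₄_pair_comm p _ v w z] using h₃ w z v)
    (fun u w z ↦ by simpa only [h.curvature₄_pair_comm p u _ w z] using h₄ w z u)
    h₃ h₄ (fun v w z ↦ by rw [curvature₄_pair_comm, k₃])
    (fun u w z ↦ by rw [curvature₄_pair_comm, k₄]) k₃ k₄ _ rfl

end LorentzianMetric
end

/-! ### The equivalence. -/

theorem proposition8 {E : Type*} [NormedAddCommGroup E] [NormedSpace ℝ E] [FiniteDimensional ℝ E]
    {M : Type*} [TopologicalSpace M] [ChartedSpace E M] [IsManifold 𝓘(ℝ, E) ∞ M]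
    (h : LorentzianMetric E M) (X : ∀ x : M, TangentSpace 𝓘(ℝ, E) x)
    (hX : h.IsBrinkmannWave X) :
    h.HasLightlikeHypersurfaceCurvature X ↔ ∀ p : M, h.curvatureNormSq p = 0 := by
  refine forall_congr' fun p ↦ ?_
  obtain ⟨n, e, Z, heX, he, hn⟩ := hX.exists_curvatureNormSq_eq p
  rw [hn]
  constructor
  · intro H
    refine Finset.sum_eq_zero fun a _ ↦ Finset.sum_eq_zero fun b _ ↦ Finset.sum_eq_zero fun c _ ↦
      Finset.sum_eq_zero fun d _ ↦ ?_
    obtain ⟨r, hr⟩ := Submodule.mem_span_singleton.1 (H _ (heX a) _ (heX b) _ (heX c))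
    rw [LorentzianMetric.curvature₄, ← hr, h.symm, map_smul, heX, smul_zero, sq, zero_mul]
  · intro H u hu v hv w hw
    have R0 : ∀ a b c d, h.curvature₄ p (e a) (e b) (e c) (e d) = 0 := by
      intro a b c d
      have nn : ∀ a b c d, 0 ≤ h.curvature₄ p (e a) (e b) (e c) (e d) ^ 2 :=
        fun _ _ _ _ ↦ sq_nonneg _
      have h₁ := (Fintype.sum_eq_zero_iff_of_nonneg fun a ↦ Finset.sum_nonneg fun b _ ↦
        Finset.sum_nonneg fun c _ ↦ Finset.sum_nonneg fun d _ ↦ nn a b c d).1 H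
      have h₂ := (Fintype.sum_eq_zero_iff_of_nonneg fun b ↦
        Finset.sum_nonneg fun c _ ↦ Finset.sum_nonneg fun d _ ↦ nn a b c d).1 (congrFun h₁ a)
      have h₃ := (Fintype.sum_eq_zero_iff_of_nonneg fun c ↦
        Finset.sum_nonneg fun d _ ↦ nn a b c d).1 (congrFun h₂ b)
      have h₄ := (Fintype.sum_eq_zero_iff_of_nonneg fun d ↦ nn a b c d).1 (congrFun h₃ c)
      exact pow_eq_zero_iff two_ne_zero |>.1 (congrFun h₄ d)
    -- `Ξ^⊥` is spanned by `X` and the `e a`, so a linear form vanishing on these vanishes on `Ξ^⊥`.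
    have ext0 : ∀ f : TangentSpace 𝓘(ℝ, E) p → ℝ, IsLinearMap ℝ f → f (X p) = 0 →
        (∀ a, f (e a) = 0) → ∀ x, h.inner p x (X p) = 0 → f x = 0 := by
      intro f hf hfX hfe x hx
      have h1 := congrArg (hf.mk' f) (he x)
      simpa only [map_add, map_sum, map_smul, IsLinearMap.mk'_apply, hx, hfX, hfe, smul_zero,
        zero_smul, Finset.sum_const_zero, add_zero] using h1
    have l₃ := h.isLinearMap_curvature₄_third p
    have l₄ := h.isLinearMap_curvature₄ p
    have k₃ := hX.curvature₄_third p
    have k₄ := hX.curvature₄_fourth p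
    -- The arguments `e a` are replaced by vectors of `Ξ^⊥` one slot at a time, with pair symmetry
    -- bringing the first two slots into the last two.
    have s₁ : ∀ w, h.inner p w (X p) = 0 → ∀ a b d, h.curvature₄ p (e a) (e b) w (e d) = 0 :=
      fun w hw a b d ↦ ext0 _ (l₃ _ _ _) (k₃ _ _ _) (fun c ↦ R0 a b c d) w hw
    have s₂ : ∀ d, h.curvature₄ p w (e d) u v = 0 := fun d ↦
      ext0 _ (l₄ _ _ _) (k₄ _ _ _) (fun b ↦ ext0 (fun u ↦ h.curvature₄ p w (e d) u (e b))
        (l₃ _ _ _) (k₃ _ _ _) (fun a ↦ by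
          rw [h.curvature₄_pair_comm]; exact s₁ w hw a b d) u hu) v hv
    have s₃ : ∀ d, h.inner p (h.curvature p u v w) (e d) = 0 := fun d ↦ by
      have := s₂ d
      rwa [h.curvature₄_pair_comm] at this
    have s₄ : h.inner p (h.curvature p u v w) (X p) = 0 := k₄ u v w
    -- The witness is the `X`-coefficient in the adapted expansion; `s₃` and `s₄` kill the `e` and
    -- `Z` coefficients.
    refine Submodule.mem_span_singleton.2 ⟨h.inner p (h.curvature p u v w) Z, ?_⟩
    conv_rhs => rw [he (h.curvature p u v w)]
    simp [s₃, s₄]
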